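/- For $\lambda\in\mathbb R$, $a\ge 0$ and $b>0$ write $\mathrm{GIG}(\lambda,a,b)$ for the probability law on $(0,\infty)$ with density $$\frac1Z\,x^{\lambda-1}e^{-ax-b/x},\qquad x>0,\qquad Z=\int_0^\infty x^{\lambda-1}e^{-ax-b/x}\,dx,$$ which is defined whenever $Z<\infty$, that is, for every $\lambda$ if $a>0$, and for $\lambda<0$ if $a=0$. A statement $W\sim\mathrm{GIG}(\lambda,a,b)$ includes the assertion that this law is defined. Let $\alpha,\beta\ge 0$ with $\alpha\ne\beta$, and let $F_1:(0,\infty)^2\to(0,\infty)^2$ be the involution $$F_1(x,y)=\left(\frac{y(1+\beta xy)}{1+\alpha xy},\ \frac{x(1+\alpha xy)}{1+\beta xy}\right).$$ Let $X$ and $Y$ be independent $(0,\infty)$-valued random variables, each with a density that is twice differentiable and strictly positive throughout $(0,\infty)$, and put $(U,V)=F_1(X,Y)$. 1. The random variables $U$ and $V$ are independent if and only if there exist $\lambda\in\mathbb R$ and $c_1,c_2>0$ such that $X\sim\mathrm{GIG}(\lambda,c_1\alpha,c_2)$ and $Y\sim\mathrm{GIG}(\lambda,c_2\beta,c_1)$.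 2. Whenever $X\sim\mathrm{GIG}(\lambda,c_1\alpha,c_2)$ and $Y\sim\mathrm{GIG}(\lambda,c_2\beta,c_1)$ with $\lambda\in\mathbb R$ and $c_1,c_2>0$, then $U\sim\mathrm{GIG}(\lambda,c_2\alpha,c_1)$ and $V\sim\mathrm{GIG}(\lambda,c_1\beta,c_2)$. 3. If $(U,V)$ has the same distribution as $(X,Y)$, then there exist $\lambda\in\mathbb R$ and $c>0$ such that $X\sim\mathrm{GIG}(\lambda,c\alpha,c)$ and $Y\sim\mathrm{GIG}(\lambda,c\beta,c)$. -/

import Mathlib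

open MeasureTheory ProbabilityTheory Set

/-- The map `(x, y) ↦ (y (1 + β x y) / (1 + α x y), x (1 + α x y) / (1 + β x y))`. It is used
only on the open quadrant `(0, ∞)²`, which it maps to itself when `α, β ≥ 0`. -/
noncomputable def gigMap (α β : ℝ) (p : ℝ × ℝ) : ℝ × ℝ :=
  (p.2 * (1 + β * p.1 * p.2) / (1 + α * p.1 * p.2),
    p.1 * (1 + α * p.1 * p.2) / (1 + β * p.1 * p.2))

theorem gigMap_mapsTo {α β : ℝ} (hα : 0 ≤ α) (hβ : 0 ≤ β) :
    MapsTo (gigMap α β) (Ioi 0 ×ˢ Ioi 0) (Ioi 0 ×ˢ Ioi 0) := by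
  rintro ⟨x, y⟩ ⟨hx, hy⟩
  simp only [mem_Ioi] at hx hy
  exact ⟨show 0 < y * (1 + β * x * y) / (1 + α * x * y) by positivity,
    show 0 < x * (1 + α * x * y) / (1 + β * x * y) by positivity⟩

/-- On the open quadrant the map is an involution. -/
theorem gigMap_gigMap {α β : ℝ} (hα : 0 ≤ α) (hβ : 0 ≤ β) {p : ℝ × ℝ}
    (hp : p ∈ Ioi (0 : ℝ) ×ˢ Ioi (0 : ℝ)) : gigMap α β (gigMap α β p) = p := by
  obtain ⟨x, y⟩ := p
  obtain ⟨hx, hy⟩ := hp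
  simp only [mem_Ioi] at hx hy
  have h1 : 0 < 1 + α * x * y := by positivity
  have h2 : 0 < 1 + β * x * y := by positivity
  have key : y * (1 + β * x * y) / (1 + α * x * y) *
      (x * (1 + α * x * y) / (1 + β * x * y)) = x * y := by
    field_simp
  simp only [gigMap, mul_assoc _ (y * _ / _) (x * _ / _), key]
  simp only [← mul_assoc]
  ext
  · simp only
    field_simp
  · simp only
    field_simp

/-- The normalizing constant `Z = ∫₀^∞ x ^ (l - 1) * exp (-a x - b / x) dx`. (If the integral
diverges, the value is `0` by Mathlib's convention.) -/
noncomputable def gigZ (l a b : ℝ) : ℝ :=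
  ∫ x in Ioi (0 : ℝ), x ^ (l - 1) * Real.exp (-a * x - b * x⁻¹)

/-- The density of `GIG(l, a, b)`. -/
noncomputable def gigPDFReal (l a b x : ℝ) : ℝ :=
  (Ioi (0 : ℝ)).indicator
    (fun x => 1 / gigZ l a b * (x ^ (l - 1) * Real.exp (-a * x - b * x⁻¹))) x

/-- The generalized inverse Gaussian law `GIG(l, a, b)`: the probability measure on `(0, ∞)` with
density proportional to `x ^ (l - 1) * exp (-a x - b / x)`. For `a, b > 0` this makes sense for
every real `l`; for `a = 0 < b` it makes sense exactly when `l < 0` (an inverse gamma law). Where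
the weight is not integrable this is the zero measure, which is not the law of any random
variable on a probability space. -/
noncomputable def gigMeasure (l a b : ℝ) : Measure ℝ :=
  volume.withDensity (fun x => ENNReal.ofReal (gigPDFReal l a b x))

/-- `f` is twice differentiable at every point of `(0, ∞)` (the second derivative need not be
continuous). -/
def TwiceDiffOnPos (f : ℝ → ℝ) : Prop :=
  DifferentiableOn ℝ f (Ioi 0) ∧ DifferentiableOn ℝ (deriv f) (Ioi 0)

/-- `X` has, under `P`, a law carried by `(0, ∞)` with a density that is strictly positive and
twice differentiable throughout `(0, ∞)`. -/
def HasNicePosDensity {Ω : Type*} [MeasurableSpace Ω] (X : Ω → ℝ) (P : Measure Ω) : Prop :=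
  ∃ f : ℝ → ℝ, (∀ x, 0 < x → 0 < f x) ∧ TwiceDiffOnPos f ∧
    HasLaw X ((volume.restrict (Ioi 0)).withDensity (fun x => ENNReal.ofReal (f x))) P

/-! In the coordinates A = log x, B = log y the map becomes (A, B) ↦ (B + r(A + B), A - r(A + B))
with r = `gigShift α β`. It preserves the product xy and Lebesgue measure on the quadrant, and it is
an involution, so the joint density f ⊗ h of (X, Y) is carried to (f ⊗ h) ∘ F₁. Independence of U
and V says that this function is a product.

Necessity: let p, q be log f, log h at exponential arguments. Separation kills the mixed derivative
of p(B + r) + q(A - r). This gives a relation, polynomial in exp(a + b), between p', p'' at a and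
q', q'' at b with a, b free (`mixed_deriv_eq_of_separated`). Eliminating b leaves a linear equation
for p', likewise for q'; substituting the solutions back leaves three shared parameters
(`exists_logDeriv_eq`), which describe GIG weights. Integrability at 0 and at ∞ then makes c₁ and c₂
positive.

Sufficiency is the algebraic identity `gigWeight_gigMap`. If (U, V) and (X, Y) have the same law, U
and V are independent, and comparing the laws of U and X gives c₁ = c₂. -/

/-! ### The functional equation in logarithmic coordinates -/

/-- The logarithm of `(1 + β t) / (1 + α t)` at `t = exp s`. -/
noncomputable def gigShift (α β s : ℝ) : ℝ :=
  Real.log (1 + β * Real.exp s) - Real.log (1 + α * Real.exp s)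

theorem hasDerivAt_gigShift {α β : ℝ} (hα : 0 ≤ α) (hβ : 0 ≤ β) (s : ℝ) :
    HasDerivAt (gigShift α β)
      (β * Real.exp s / (1 + β * Real.exp s) - α * Real.exp s / (1 + α * Real.exp s)) s := by
  have h : ∀ {c : ℝ}, 0 ≤ c → HasDerivAt (fun s => Real.log (1 + c * Real.exp s))
      (c * Real.exp s / (1 + c * Real.exp s)) s := fun {c} hc =>
    (((Real.hasDerivAt_exp s).const_mul c).const_add 1).log (by positivity)
  exact (h hβ).sub (h hα)

theorem hasDerivAt_deriv_gigShift {α β : ℝ} (hα : 0 ≤ α) (hβ : 0 ≤ β) (s : ℝ) :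
    HasDerivAt
      (fun s => β * Real.exp s / (1 + β * Real.exp s) - α * Real.exp s / (1 + α * Real.exp s))
      (β * Real.exp s / (1 + β * Real.exp s) ^ 2 - α * Real.exp s / (1 + α * Real.exp s) ^ 2)
      s := by
  have h : ∀ {c : ℝ}, 0 ≤ c → HasDerivAt (fun s => c * Real.exp s / (1 + c * Real.exp s))
      (c * Real.exp s / (1 + c * Real.exp s) ^ 2) s := by
    intro c hc
    have h0 : (1 + c * Real.exp s) ≠ 0 := by positivity
    have h1 := (Real.hasDerivAt_exp s).const_mul c
    refine (h1.div (h1.const_add 1) h0).congr_deriv ?_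
    ring
  exact (h hβ).sub (h hα)

/-- If `p x + q y`, read in the logarithmic coordinates of the image of `gigMap`, separates, then
its mixed derivative vanishes. -/
theorem mixed_deriv_eq_of_separated {α β : ℝ} (hα : 0 ≤ α) (hβ : 0 ≤ β) (hαβ : α ≠ β)
    {p p₁ p₂ q q₁ q₂ φ ψ : ℝ → ℝ}
    (hp : ∀ a, HasDerivAt p (p₁ a) a) (hp₁ : ∀ a, HasDerivAt p₁ (p₂ a) a)
    (hq : ∀ a, HasDerivAt q (q₁ a) a) (hq₁ : ∀ a, HasDerivAt q₁ (q₂ a) a)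
    (hsep : ∀ A B, p (B + gigShift α β (A + B)) + q (A - gigShift α β (A + B)) = φ A + ψ B)
    (a b : ℝ) :
    (1 + 2 * β * Real.exp (a + b) + α * β * Real.exp (a + b) ^ 2) * p₂ a +
        (1 - α * β * Real.exp (a + b) ^ 2) * p₁ a =
      (1 + 2 * α * Real.exp (a + b) + α * β * Real.exp (a + b) ^ 2) * q₂ b +
        (1 - α * β * Real.exp (a + b) ^ 2) * q₁ b := by
  set r := gigShift α β with hr
  set r₁ : ℝ → ℝ := fun s =>
    β * Real.exp s / (1 + β * Real.exp s) - α * Real.exp s / (1 + α * Real.exp s) with hr₁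
  set r₂ : ℝ → ℝ := fun s =>
    β * Real.exp s / (1 + β * Real.exp s) ^ 2 - α * Real.exp s / (1 + α * Real.exp s) ^ 2 with hr₂
  have dr : ∀ s, HasDerivAt r (r₁ s) s := hasDerivAt_gigShift hα hβ
  have dr₁ : ∀ s, HasDerivAt r₁ (r₂ s) s := hasDerivAt_deriv_gigShift hα hβ
  have sB : ∀ A B : ℝ, HasDerivAt (fun B => A + B) 1 B := fun A B => (hasDerivAt_id B).const_add A
  have sA : ∀ A B : ℝ, HasDerivAt (fun A => A + B) 1 A := fun A B => (hasDerivAt_id A).add_const B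
  -- Neither φ nor ψ is assumed differentiable: differentiability of ψ is read off the separated
  -- identity. Its derivative at B is expressed through any A whatever.
  have dψ : ∀ A B, HasDerivAt ψ
      (p₁ (B + r (A + B)) * (1 + r₁ (A + B)) - q₁ (A - r (A + B)) * r₁ (A + B)) B := by
    intro A B
    have e : ψ = fun B => p (B + r (A + B)) + q (A - r (A + B)) - φ A := by
      funext B; rw [hsep]; ring
    rw [e]
    have h1 : HasDerivAt (fun B => r (A + B)) (r₁ (A + B) * 1) B := (dr _).comp B (sB A B)
    have h2 := (hp _).comp B ((hasDerivAt_id B).add h1)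
    have h3 := (hq _).comp B (h1.const_sub A)
    refine ((h2.add h3).sub_const (φ A)).congr_deriv ?_
    simp only [id, Pi.add_apply]
    ring
  set s := a + b with hs
  -- At B = a - r(s), ψ'(B) does not depend on A. Differentiating in A at A = b + r(s), where A + B
  -- = s, B + r = a and A - r = b, gives the relation at (a, b). No continuity of second derivatives
  -- is needed.
  have hconst : (fun A => p₁ (a - r s + r (A + (a - r s))) * (1 + r₁ (A + (a - r s))) -
      q₁ (A - r (A + (a - r s))) * r₁ (A + (a - r s))) =
      fun _ => p₁ (a - r s + r (0 + (a - r s))) * (1 + r₁ (0 + (a - r s))) -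
      q₁ (0 - r (0 + (a - r s))) * r₁ (0 + (a - r s)) :=
    funext fun A => (dψ A _).unique (dψ 0 _)
  have hzero : HasDerivAt (fun A => p₁ (a - r s + r (A + (a - r s))) * (1 + r₁ (A + (a - r s))) -
      q₁ (A - r (A + (a - r s))) * r₁ (A + (a - r s))) 0 (b + r s) := by
    rw [hconst]; exact hasDerivAt_const _ _
  have hder : HasDerivAt (fun A => p₁ (a - r s + r (A + (a - r s))) * (1 + r₁ (A + (a - r s))) -
      q₁ (A - r (A + (a - r s))) * r₁ (A + (a - r s)))
      (p₂ a * r₁ s * (1 + r₁ s) + p₁ a * r₂ s - (q₂ b * (1 - r₁ s) * r₁ s + q₁ b * r₂ s))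
      (b + r s) := by
    have es : b + r s + (a - r s) = s := by rw [hs]; ring
    have h1 : HasDerivAt (fun A => r (A + (a - r s))) (r₁ s) (b + r s) := by
      have := (dr (b + r s + (a - r s))).comp (b + r s) (sA (b + r s) (a - r s))
      rw [es, mul_one] at this
      exact this
    have h2 : HasDerivAt (fun A => r₁ (A + (a - r s))) (r₂ s) (b + r s) := by
      have := (dr₁ (b + r s + (a - r s))).comp (b + r s) (sA (b + r s) (a - r s))
      rw [es, mul_one] at this
      exact this
    have h3 := (hp₁ (a - r s + r (b + r s + (a - r s)))).comp (b + r s) (h1.const_add (a - r s))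
    have h4 := (hq₁ ((b + r s) - r (b + r s + (a - r s)))).comp (b + r s)
      ((hasDerivAt_id (b + r s)).sub h1)
    refine ((h3.mul (h2.const_add 1)).sub (h4.mul h2)).congr_deriv ?_
    simp only [Function.comp, es, id, Pi.sub_apply]
    rw [sub_add_cancel, add_sub_cancel_right]
  have key := hder.unique hzero
  have hβα : β - α ≠ 0 := sub_ne_zero.2 hαβ.symm
  set t := Real.exp s with ht
  have htpos : 0 < t := Real.exp_pos s
  have n1 : 1 + α * t ≠ 0 := by positivity
  have n2 : 1 + β * t ≠ 0 := by positivity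
  have e1 : r₁ s = (β - α) * t / ((1 + α * t) * (1 + β * t)) := by
    simp only [hr₁, ← ht]; field_simp; ring
  -- Every term thus carries the factor r'(s)/((1 + αt)(1 + βt)), nonzero because α ≠ β.
  have e2 : r₂ s = (β - α) * t / ((1 + α * t) * (1 + β * t)) *
      ((1 - α * β * t ^ 2) / ((1 + α * t) * (1 + β * t))) := by
    simp only [hr₂, ← ht]; field_simp; ring
  have e3 : 1 + r₁ s = (1 + 2 * β * t + α * β * t ^ 2) / ((1 + α * t) * (1 + β * t)) := by
    rw [e1]; field_simp; ring
  have e4 : 1 - r₁ s = (1 + 2 * α * t + α * β * t ^ 2) / ((1 + α * t) * (1 + β * t)) := by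
    rw [e1]; field_simp; ring
  rw [e3, e4, e2, e1] at key
  have hfac : (β - α) * t / ((1 + α * t) * (1 + β * t)) / ((1 + α * t) * (1 + β * t)) ≠ 0 := by
    have := htpos.ne'
    positivity
  rw [← sub_eq_zero]
  refine (mul_eq_zero.1 ?_).resolve_left hfac
  rw [← key]
  ring

/-- Solutions of `g + g' = a₀ + a₁ eᵃ + a₂ e²ᵃ`. -/
theorem exists_eq_of_add_deriv_eq {g g' : ℝ → ℝ} {a₀ a₁ a₂ : ℝ}
    (hg : ∀ a, HasDerivAt g (g' a) a)
    (h : ∀ a, g a + g' a = a₀ + a₁ * Real.exp a + a₂ * Real.exp a ^ 2) :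
    ∃ c, ∀ a, g a = a₀ + a₁ / 2 * Real.exp a + a₂ / 3 * Real.exp a ^ 2 - c * Real.exp (-a) ∧
      g' a = a₁ / 2 * Real.exp a + 2 * a₂ / 3 * Real.exp a ^ 2 + c * Real.exp (-a) := by
  -- The integrating factor is exp a, since (exp a · g)' = exp a · (g + g').
  have hd : ∀ a, HasDerivAt (fun a => a₀ * Real.exp a + a₁ / 2 * Real.exp a ^ 2 +
      a₂ / 3 * Real.exp a ^ 3 - Real.exp a * g a) 0 a := by
    intro a
    have he := Real.hasDerivAt_exp a
    refine (((he.const_mul a₀).add ((he.pow 2).const_mul (a₁ / 2))).add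
      ((he.pow 3).const_mul (a₂ / 3)) |>.sub (he.mul (hg a))).congr_deriv ?_
    have : g' a = a₀ + a₁ * Real.exp a + a₂ * Real.exp a ^ 2 - g a := by rw [← h]; ring
    rw [this]
    push_cast
    ring
  have hc := is_const_of_deriv_eq_zero (fun a => (hd a).differentiableAt) (fun a => (hd a).deriv)
  refine ⟨a₀ * Real.exp 0 + a₁ / 2 * Real.exp 0 ^ 2 +
      a₂ / 3 * Real.exp 0 ^ 3 - Real.exp 0 * g 0, fun a => ?_⟩
  have h1 := hc a 0
  rw [← h1]
  have hg1 : g a = a₀ + a₁ / 2 * Real.exp a + a₂ / 3 * Real.exp a ^ 2 -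
      (a₀ * Real.exp a + a₁ / 2 * Real.exp a ^ 2 +
      a₂ / 3 * Real.exp a ^ 3 - Real.exp a * g a) * Real.exp (-a) := by
    rw [Real.exp_neg]
    have := (Real.exp_pos a).ne'
    field_simp
    ring
  refine ⟨hg1, ?_⟩
  linarith [h a]

/-- With a fixed, the left side is a quadratic in y = exp b whose value at y = 0 is p₁ + p₂. The
weights 3, -3, 1 at y = 1, 2, 3 extrapolate a quadratic to y = 0. -/
theorem add_deriv_eq_quadratic {α β : ℝ} {p₁ p₂ q₁ q₂ : ℝ → ℝ}
    (h : ∀ a b : ℝ, (1 + 2 * β * Real.exp (a + b) + α * β * Real.exp (a + b) ^ 2) * p₂ a +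
        (1 - α * β * Real.exp (a + b) ^ 2) * p₁ a =
      (1 + 2 * α * Real.exp (a + b) + α * β * Real.exp (a + b) ^ 2) * q₂ b +
        (1 - α * β * Real.exp (a + b) ^ 2) * q₁ b) :
    ∃ a₀ a₁ a₂ : ℝ, ∀ a, p₁ a + p₂ a = a₀ + a₁ * Real.exp a + a₂ * Real.exp a ^ 2 := by
  have h1 := fun a => h a 0
  have h2 := fun a => h a (Real.log 2)
  have h3 := fun a => h a (Real.log 3)
  simp only [Real.exp_add, Real.exp_zero, Real.exp_log (zero_lt_two' ℝ),
    Real.exp_log (zero_lt_three' ℝ)] at h1 h2 h3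
  refine ⟨3 * (q₂ 0 + q₁ 0) - 3 * (q₂ (Real.log 2) + q₁ (Real.log 2)) +
      (q₂ (Real.log 3) + q₁ (Real.log 3)),
    2 * α * (3 * q₂ 0 - 6 * q₂ (Real.log 2) + 3 * q₂ (Real.log 3)),
    α * β * (3 * (q₂ 0 - q₁ 0) - 12 * (q₂ (Real.log 2) - q₁ (Real.log 2)) +
      9 * (q₂ (Real.log 3) - q₁ (Real.log 3))), fun a => ?_⟩
  linear_combination 3 * h1 a - 3 * h2 a + h3 a

/-- The relation is symmetric under exchanging (p, α) with (q, β), so both p₁ and q₁ solve an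
equation as in `exists_eq_of_add_deriv_eq`. Putting the solutions back gives a polynomial identity
that ties their constants together. -/
theorem exists_logDeriv_eq {α β : ℝ} {p₁ p₂ q₁ q₂ : ℝ → ℝ}
    (hp₁ : ∀ a, HasDerivAt p₁ (p₂ a) a) (hq₁ : ∀ a, HasDerivAt q₁ (q₂ a) a)
    (h : ∀ a b : ℝ, (1 + 2 * β * Real.exp (a + b) + α * β * Real.exp (a + b) ^ 2) * p₂ a +
        (1 - α * β * Real.exp (a + b) ^ 2) * p₁ a =
      (1 + 2 * α * Real.exp (a + b) + α * β * Real.exp (a + b) ^ 2) * q₂ b +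
        (1 - α * β * Real.exp (a + b) ^ 2) * q₁ b) :
    ∃ k c d : ℝ, (∀ a, p₁ a = k + α * d * Real.exp a - c * Real.exp (-a)) ∧
      ∀ b, q₁ b = k + β * c * Real.exp b - d * Real.exp (-b) := by
  obtain ⟨a₀, a₁, a₂, ha⟩ := add_deriv_eq_quadratic h
  obtain ⟨b₀, b₁, b₂, hb⟩ := add_deriv_eq_quadratic (α := β) (β := α) (p₁ := q₁) (p₂ := q₂)
    (q₁ := p₁) (q₂ := p₂) (fun a b => by
      have := h b a
      rw [add_comm b a, mul_comm α β] at this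
      exact this.symm)
  obtain ⟨c, hc⟩ := exists_eq_of_add_deriv_eq hp₁ ha
  obtain ⟨d, hd⟩ := exists_eq_of_add_deriv_eq hq₁ hb
  have hpoly : ∀ x y : ℝ, 0 < x → 0 < y →
      a₀ + a₁ * x + a₂ * x ^ 2 + 2 * β * y * (a₁ / 2 * x ^ 2 + 2 * a₂ / 3 * x ^ 3 + c) +
        α * β * y ^ 2 * x * (-a₀ * x + a₂ / 3 * x ^ 3 + 2 * c) =
      b₀ + b₁ * y + b₂ * y ^ 2 + 2 * α * x * (b₁ / 2 * y ^ 2 + 2 * b₂ / 3 * y ^ 3 + d) +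
        α * β * x ^ 2 * y * (-b₀ * y + b₂ / 3 * y ^ 3 + 2 * d) := by
    intro x y hx hy
    have := h (Real.log x) (Real.log y)
    rw [(hc _).1, (hc _).2, (hd _).1, (hd _).2, Real.exp_add, Real.exp_neg, Real.exp_neg,
      Real.exp_log hx, Real.exp_log hy] at this
    have hx' := hx.ne'
    have hy' := hy.ne'
    have hxi : x * x⁻¹ = 1 := mul_inv_cancel₀ hx'
    have hyi : y * y⁻¹ = 1 := mul_inv_cancel₀ hy'
    linear_combination this - 2 * β * y * c * hxi - 2 * α * β * y ^ 2 * x * c * hxi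
      + 2 * α * x * d * hyi + 2 * α * β * x ^ 2 * y * d * hyi
  -- Continuity extends the identity to the axes, where it involves one variable only and its
  -- coefficients can be compared.
  have h0 : ∀ x y : ℝ, 0 ≤ x → 0 ≤ y →
      a₀ + a₁ * x + a₂ * x ^ 2 + 2 * β * y * (a₁ / 2 * x ^ 2 + 2 * a₂ / 3 * x ^ 3 + c) +
        α * β * y ^ 2 * x * (-a₀ * x + a₂ / 3 * x ^ 3 + 2 * c) =
      b₀ + b₁ * y + b₂ * y ^ 2 + 2 * α * x * (b₁ / 2 * y ^ 2 + 2 * b₂ / 3 * y ^ 3 + d) +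
        α * β * x ^ 2 * y * (-b₀ * y + b₂ / 3 * y ^ 3 + 2 * d) := by
    have hcl : closure (Ioi (0 : ℝ) ×ˢ Ioi (0 : ℝ)) = Ici 0 ×ˢ Ici 0 := by
      rw [closure_prod_eq, closure_Ioi]
    intro x y hx hy
    have hmem : (x, y) ∈ closure (Ioi (0 : ℝ) ×ˢ Ioi (0 : ℝ)) := by rw [hcl]; exact ⟨hx, hy⟩
    have heq : EqOn (fun z : ℝ × ℝ => a₀ + a₁ * z.1 + a₂ * z.1 ^ 2 +
        2 * β * z.2 * (a₁ / 2 * z.1 ^ 2 + 2 * a₂ / 3 * z.1 ^ 3 + c) +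
        α * β * z.2 ^ 2 * z.1 * (-a₀ * z.1 + a₂ / 3 * z.1 ^ 3 + 2 * c))
      (fun z : ℝ × ℝ => b₀ + b₁ * z.2 + b₂ * z.2 ^ 2 +
        2 * α * z.1 * (b₁ / 2 * z.2 ^ 2 + 2 * b₂ / 3 * z.2 ^ 3 + d) +
        α * β * z.1 ^ 2 * z.2 * (-b₀ * z.2 + b₂ / 3 * z.2 ^ 3 + 2 * d))
      (Ioi (0 : ℝ) ×ˢ Ioi (0 : ℝ)) := fun z hz => hpoly z.1 z.2 hz.1 hz.2
    exact heq.closure (by fun_prop) (by fun_prop) hmem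
  have e0 := h0 0 0 le_rfl le_rfl
  have e1 := h0 1 0 zero_le_one le_rfl
  have e2 := h0 2 0 zero_le_two le_rfl
  have e3 := h0 0 1 le_rfl zero_le_one
  have e4 := h0 0 2 le_rfl zero_le_two
  simp only [mul_zero, zero_mul, add_zero, zero_add, mul_one, one_pow, ne_eq, OfNat.ofNat_ne_zero,
    not_false_eq_true, zero_pow] at e0 e1 e2 e3 e4
  have ha₂ : a₂ = 0 := by linarith
  have hb₂ : b₂ = 0 := by linarith
  have ha₁ : a₁ = 2 * (α * d) := by linarith
  have hb₁ : b₁ = 2 * (β * c) := by linarith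
  subst ha₂ hb₂ ha₁ hb₁ e0
  refine ⟨a₀, c, d, fun a => ?_, fun b => ?_⟩
  · rw [(hc a).1]; ring
  · rw [(hd b).1]; ring

/-- A function on the line with derivative `k + m eᵃ - c e⁻ᵃ`. -/
theorem exists_eq_of_hasDerivAt {p : ℝ → ℝ} {k m c : ℝ}
    (hp : ∀ a, HasDerivAt p (k + m * Real.exp a - c * Real.exp (-a)) a) :
    ∃ K, ∀ a, p a = K + k * a + m * Real.exp a + c * Real.exp (-a) := by
  have hd : ∀ a, HasDerivAt (fun a => p a - (k * a + m * Real.exp a + c * Real.exp (-a))) 0 a := by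
    intro a
    have h1 := (Real.hasDerivAt_exp (-a)).comp a (hasDerivAt_neg a)
    refine ((hp a).sub ((((hasDerivAt_id a).const_mul k).add
      ((Real.hasDerivAt_exp a).const_mul m)).add (h1.const_mul c))).congr_deriv ?_
    ring
  have hc := is_const_of_deriv_eq_zero (fun a => (hd a).differentiableAt) (fun a => (hd a).deriv)
  refine ⟨p 0 - (k * 0 + m * Real.exp 0 + c * Real.exp (-0)), fun a => ?_⟩
  have := hc a 0
  rw [← this]
  ring

theorem TwiceDiffOnPos.exists_hasDerivAt_log_exp {f : ℝ → ℝ} (hf : TwiceDiffOnPos f)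
    (hpos : ∀ x, 0 < x → 0 < f x) :
    ∃ p₁ p₂ : ℝ → ℝ, (∀ a, HasDerivAt (fun a => Real.log (f (Real.exp a))) (p₁ a) a) ∧
      ∀ a, HasDerivAt p₁ (p₂ a) a := by
  have hd : ∀ a, DifferentiableAt ℝ (fun a => f (Real.exp a)) a := fun a =>
    (hf.1.differentiableAt (Ioi_mem_nhds (Real.exp_pos a))).comp a Real.differentiableAt_exp
  have hd' : ∀ a, DifferentiableAt ℝ (fun a => deriv f (Real.exp a)) a := fun a =>
    (hf.2.differentiableAt (Ioi_mem_nhds (Real.exp_pos a))).comp a Real.differentiableAt_exp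
  refine ⟨fun a => deriv f (Real.exp a) * Real.exp a / f (Real.exp a), _, fun a => ?_, fun a =>
    DifferentiableAt.hasDerivAt (((hd' a).mul Real.differentiableAt_exp).div (hd a)
      (hpos _ (Real.exp_pos a)).ne')⟩
  exact ((hf.1.differentiableAt (Ioi_mem_nhds (Real.exp_pos a))).hasDerivAt.comp a
    (Real.hasDerivAt_exp a)).log (hpos _ (Real.exp_pos a)).ne'

/-- The shift enters the two coordinates with opposite signs because the map preserves xy. -/
theorem gigMap_exp {α β : ℝ} (hα : 0 ≤ α) (hβ : 0 ≤ β) (A B : ℝ) :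
    gigMap α β (Real.exp A, Real.exp B) =
      (Real.exp (B + gigShift α β (A + B)), Real.exp (A - gigShift α β (A + B))) := by
  have h1 : 0 < 1 + α * Real.exp (A + B) := by positivity
  have h2 : 0 < 1 + β * Real.exp (A + B) := by positivity
  have e : Real.exp (gigShift α β (A + B)) =
      (1 + β * Real.exp (A + B)) / (1 + α * Real.exp (A + B)) := by
    rw [gigShift, Real.exp_sub, Real.exp_log h1, Real.exp_log h2]
  rw [Real.exp_add B, Real.exp_sub A, e, gigMap]
  simp only [mul_assoc, ← Real.exp_add]
  rw [div_div_eq_mul_div]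
  simp only [mul_div_assoc]

/-- The functional equation behind the independence property: densities `f`, `h` for which
`f ⊗ h` composed with `gigMap` is a product are generalized inverse Gaussian weights. -/
theorem exists_eq_gig_weight {α β : ℝ} (hα : 0 ≤ α) (hβ : 0 ≤ β) (hαβ : α ≠ β) {f h : ℝ → ℝ}
    (hf : TwiceDiffOnPos f) (hfpos : ∀ x, 0 < x → 0 < f x)
    (hh : TwiceDiffOnPos h) (hhpos : ∀ x, 0 < x → 0 < h x)
    (hsep : ∀ u u' v v' : ℝ, 0 < u → 0 < u' → 0 < v → 0 < v' →
      f (gigMap α β (u, v)).1 * h (gigMap α β (u, v)).2 *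
        (f (gigMap α β (u', v')).1 * h (gigMap α β (u', v')).2) =
      f (gigMap α β (u, v')).1 * h (gigMap α β (u, v')).2 *
        (f (gigMap α β (u', v)).1 * h (gigMap α β (u', v)).2)) :
    ∃ l c₁ c₂ K L : ℝ, 0 < K ∧ 0 < L ∧
      (∀ x, 0 < x → f x = K * (x ^ (l - 1) * Real.exp (-(c₁ * α) * x - c₂ * x⁻¹))) ∧
      ∀ x, 0 < x → h x = L * (x ^ (l - 1) * Real.exp (-(c₂ * β) * x - c₁ * x⁻¹)) := by
  obtain ⟨p₁, p₂, hp, hp₁⟩ := hf.exists_hasDerivAt_log_exp hfpos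
  obtain ⟨q₁, q₂, hq, hq₁⟩ := hh.exists_hasDerivAt_log_exp hhpos
  set p := fun a => Real.log (f (Real.exp a)) with hpdef
  set q := fun a => Real.log (h (Real.exp a)) with hqdef
  set G : ℝ → ℝ → ℝ := fun A B =>
    p (B + gigShift α β (A + B)) + q (A - gigShift α β (A + B)) with hG
  have hGlog : ∀ A B, G A B = Real.log (f (gigMap α β (Real.exp A, Real.exp B)).1 *
      h (gigMap α β (Real.exp A, Real.exp B)).2) := by
    intro A B
    rw [gigMap_exp hα hβ, Real.log_mul (hfpos _ (Real.exp_pos _)).ne'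
      (hhpos _ (Real.exp_pos _)).ne']
  have hpos : ∀ A B, 0 < f (gigMap α β (Real.exp A, Real.exp B)).1 *
      h (gigMap α β (Real.exp A, Real.exp B)).2 := by
    intro A B
    rw [gigMap_exp hα hβ]
    exact mul_pos (hfpos _ (Real.exp_pos _)) (hhpos _ (Real.exp_pos _))
  -- The four-point identity with base point u' = v' = 1.
  have hGsep : ∀ A B, G A B = G A 0 + (G 0 B - G 0 0) := by
    intro A B
    have := congrArg Real.log (hsep (Real.exp A) (Real.exp 0) (Real.exp B) (Real.exp 0)
      (Real.exp_pos _) (Real.exp_pos _) (Real.exp_pos _) (Real.exp_pos _))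
    rw [Real.log_mul (hpos _ _).ne' (hpos _ _).ne', Real.log_mul (hpos _ _).ne' (hpos _ _).ne',
      ← hGlog, ← hGlog, ← hGlog, ← hGlog] at this
    linarith
  obtain ⟨k, c, d, hp', hq'⟩ := exists_logDeriv_eq hp₁ hq₁
    (mixed_deriv_eq_of_separated (φ := fun A => G A 0) (ψ := fun B => G 0 B - G 0 0)
      hα hβ hαβ hp hp₁ hq hq₁ hGsep)
  obtain ⟨K, hK⟩ := exists_eq_of_hasDerivAt (fun a => hp' a ▸ hp a)
  obtain ⟨L, hL⟩ := exists_eq_of_hasDerivAt (fun a => hq' a ▸ hq a)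
  have aux : ∀ {f : ℝ → ℝ} {m c K : ℝ}, (∀ x, 0 < x → 0 < f x) →
      (∀ a, Real.log (f (Real.exp a)) = K + k * a + m * Real.exp a + c * Real.exp (-a)) →
      ∀ x, 0 < x → f x = Real.exp K * (x ^ (k + 1 - 1) * Real.exp (m * x + c * x⁻¹)) := by
    intro f m c K hf h x hx
    have := h (Real.log x)
    rw [Real.exp_neg, Real.exp_log hx] at this
    rw [← Real.exp_log (hf x hx), this, Real.rpow_def_of_pos hx, ← Real.exp_add, ← Real.exp_add]
    congr 1
    ring
  -- The signs of c₁ = -d and c₂ = -c are still unknown here; only integrability decides them.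
  refine ⟨k + 1, -d, -c, Real.exp K, Real.exp L, Real.exp_pos _, Real.exp_pos _,
    fun x hx => ?_, fun x hx => ?_⟩
  · rw [aux hfpos hK x hx]
    congr 3
    ring
  · rw [aux hhpos hL x hx]
    congr 3
    ring

/-! ### Change of variables under the involution -/

/-- Lebesgue measure on `(0, ∞)`. -/
noncomputable abbrev posVolume : Measure ℝ := volume.restrict (Ioi 0)

theorem posVolume_prod :
    posVolume.prod posVolume = (volume : Measure (ℝ × ℝ)).restrict (Ioi 0 ×ˢ Ioi 0) :=
  Measure.prod_restrict _ _

theorem measurable_gigMap (α β : ℝ) : Measurable (gigMap α β) := by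
  unfold gigMap
  fun_prop

theorem continuousOn_gigMap {α β : ℝ} (hα : 0 ≤ α) (hβ : 0 ≤ β) :
    ContinuousOn (gigMap α β) (Ioi 0 ×ˢ Ioi 0) := by
  have h : ∀ c : ℝ, 0 ≤ c → ∀ z ∈ Ioi (0 : ℝ) ×ˢ Ioi (0 : ℝ), 1 + c * z.1 * z.2 ≠ 0 := by
    rintro c hc ⟨x, y⟩ ⟨hx, hy⟩
    simp only [mem_Ioi] at hx hy
    positivity
  unfold gigMap
  exact ContinuousOn.prodMk (ContinuousOn.div (by fun_prop) (by fun_prop) (h α hα))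
    (ContinuousOn.div (by fun_prop) (by fun_prop) (h β hβ))

/-- On the open quadrant the derivative of `gigMap` has determinant `-1`. -/
theorem exists_hasFDerivAt_gigMap {α β : ℝ} (hα : 0 ≤ α) (hβ : 0 ≤ β) {z : ℝ × ℝ}
    (hz : z ∈ Ioi (0 : ℝ) ×ˢ Ioi (0 : ℝ)) :
    ∃ L : ℝ × ℝ →L[ℝ] ℝ × ℝ, HasFDerivAt (gigMap α β) L z ∧ L.det = -1 := by
  obtain ⟨x, y⟩ := z
  obtain ⟨hx, hy⟩ := hz
  simp only [mem_Ioi] at hx hy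
  have ha : 0 < 1 + α * x * y := by positivity
  have hb : 0 < 1 + β * x * y := by positivity
  have hfst : HasFDerivAt (Prod.fst : ℝ × ℝ → ℝ) (ContinuousLinearMap.fst ℝ ℝ ℝ) (x, y) :=
    hasFDerivAt_fst
  have hsnd : HasFDerivAt (Prod.snd : ℝ × ℝ → ℝ) (ContinuousLinearMap.snd ℝ ℝ ℝ) (x, y) :=
    hasFDerivAt_snd
  have hlin : ∀ c : ℝ, HasFDerivAt (fun z : ℝ × ℝ => 1 + c * z.1 * z.2) _ (x, y) := fun c =>
    ((hfst.const_mul c).mul hsnd).const_add 1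
  have hinv : ∀ c : ℝ, 0 < 1 + c * x * y →
      HasFDerivAt (fun z : ℝ × ℝ => (1 + c * z.1 * z.2)⁻¹) _ (x, y) := fun c hc =>
    (hasDerivAt_inv hc.ne').comp_hasFDerivAt (x, y) (hlin c)
  have h1 := (hsnd.mul (hlin β)).mul (hinv α ha)
  have h2 := (hfst.mul (hlin α)).mul (hinv β hb)
  refine ⟨(Matrix.toLin (.finTwoProd ℝ) (.finTwoProd ℝ)
    !![y ^ 2 * (β - α) / (1 + α * x * y) ^ 2,
        (1 + β * x * y) / (1 + α * x * y) + x * y * (β - α) / (1 + α * x * y) ^ 2;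
      (1 + α * x * y) / (1 + β * x * y) + x * y * (α - β) / (1 + β * x * y) ^ 2,
        x ^ 2 * (α - β) / (1 + β * x * y) ^ 2]).toContinuousLinearMap, ?_, ?_⟩
  · refine (h1.prodMk h2).congr_fderiv ?_
    rw [Matrix.toLin_finTwoProd_toContinuousLinearMap]
    ext <;> simp <;> field_simp <;> ring
  · simp only [LinearMap.det_toContinuousLinearMap, LinearMap.det_toLin, Matrix.det_fin_two_of]
    field_simp
    ring

theorem measurePreserving_gigMap {α β : ℝ} (hα : 0 ≤ α) (hβ : 0 ≤ β) :
    MeasurePreserving (gigMap α β) (posVolume.prod posVolume) (posVolume.prod posVolume) := by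
  refine ⟨measurable_gigMap α β, ?_⟩
  rw [posVolume_prod]
  set Q : Set (ℝ × ℝ) := Ioi 0 ×ˢ Ioi 0 with hQ
  have hQm : MeasurableSet Q := measurableSet_Ioi.prod measurableSet_Ioi
  choose! L hL hdet using fun z (hz : z ∈ Q) => exists_hasFDerivAt_gigMap hα hβ hz
  have himage : gigMap α β '' Q = Q :=
    (gigMap_mapsTo hα hβ).image_subset.antisymm fun z hz =>
      ⟨gigMap α β z, gigMap_mapsTo hα hβ hz, gigMap_gigMap hα hβ hz⟩
  have hinj : InjOn (gigMap α β) Q := LeftInvOn.injOn (f₁' := gigMap α β) fun z hz =>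
    gigMap_gigMap hα hβ hz
  have key := map_withDensity_abs_det_fderiv_eq_addHaar (volume : Measure (ℝ × ℝ))
    hQm.nullMeasurableSet (fun z hz => (hL z hz).hasFDerivWithinAt) hinj
  rw [himage] at key
  rw [withDensity_congr_ae (g := 1), withDensity_one] at key
  · exact key
  · filter_upwards [ae_restrict_mem hQm] with z hz
    simp [hdet z hz]

theorem ae_mem_quadrant : ∀ᵐ z ∂posVolume.prod posVolume, z ∈ Ioi (0 : ℝ) ×ˢ Ioi (0 : ℝ) := by
  rw [posVolume_prod]
  exact ae_restrict_mem (measurableSet_Ioi.prod measurableSet_Ioi)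

/-- The map preserves the measure and is its own inverse on the quadrant, so pushing a density
forward is composing with the map. -/
theorem map_gigMap_withDensity {α β : ℝ} (hα : 0 ≤ α) (hβ : 0 ≤ β) {g : ℝ × ℝ → ENNReal}
    (hg : AEMeasurable g (posVolume.prod posVolume)) :
    ((posVolume.prod posVolume).withDensity g).map (gigMap α β) =
      (posVolume.prod posVolume).withDensity (g ∘ gigMap α β) := by
  have hF := measurePreserving_gigMap hα hβ
  ext s hs
  rw [Measure.map_apply hF.measurable hs, withDensity_apply _ (hF.measurable hs),
    withDensity_apply _ hs, ← lintegral_indicator (hF.measurable hs), ← lintegral_indicator hs]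
  have hm := hg.indicator (hF.measurable hs)
  rw [← hF.map_eq] at hm
  conv_lhs => rw [← hF.map_eq, lintegral_map' hm hF.aemeasurable]
  refine lintegral_congr_ae ?_
  filter_upwards [ae_mem_quadrant] with z hz
  have hiff : gigMap α β z ∈ gigMap α β ⁻¹' s ↔ z ∈ s := by
    rw [mem_preimage, gigMap_gigMap hα hβ hz]
  by_cases hzs : z ∈ s
  · rw [indicator_of_mem (hiff.2 hzs), indicator_of_mem hzs, Function.comp]
  · rw [indicator_of_notMem (hiff.not.2 hzs), indicator_of_notMem hzs]

/-! ### Densities of product measures -/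

/-- A continuous positive density of a product measure factorizes at every point. -/
theorem mul_eq_mul_of_withDensity_eq_prod {G : ℝ × ℝ → ℝ}
    (hG : ContinuousOn G (Ioi 0 ×ˢ Ioi 0)) (hpos : ∀ z ∈ Ioi (0 : ℝ) ×ˢ Ioi (0 : ℝ), 0 < G z)
    {m₁ m₂ : Measure ℝ} [IsProbabilityMeasure m₁] [IsProbabilityMeasure m₂]
    (h : (posVolume.prod posVolume).withDensity (fun z => ENNReal.ofReal (G z)) = m₁.prod m₂)
    {u u' v v' : ℝ} (hu : 0 < u) (hu' : 0 < u') (hv : 0 < v) (hv' : 0 < v') :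
    G (u, v) * G (u', v') = G (u, v') * G (u', v) := by
  have hGm : AEMeasurable (fun z => ENNReal.ofReal (G z)) (posVolume.prod posVolume) := by
    rw [posVolume_prod]
    exact (hG.aemeasurable (measurableSet_Ioi.prod measurableSet_Ioi)).ennreal_ofReal
  have hac : m₁.prod m₂ ≪ posVolume.prod posVolume := by
    rw [← h]; exact withDensity_absolutelyContinuous _ _
  have hac₁ : m₁ ≪ posVolume := by
    have h1 := (hac.map measurable_fst).trans
      Measure.quasiMeasurePreserving_fst.absolutelyContinuous
    rwa [Measure.map_fst_prod, measure_univ, one_smul] at h1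
  have hac₂ : m₂ ≪ posVolume := by
    have h1 := (hac.map measurable_snd).trans
      Measure.quasiMeasurePreserving_snd.absolutelyContinuous
    rwa [Measure.map_snd_prod, measure_univ, one_smul] at h1
  set φ := m₁.rnDeriv posVolume with hφ
  set ψ := m₂.rnDeriv posVolume with hψ
  have hprod : (posVolume.prod posVolume).withDensity (fun z => ENNReal.ofReal (G z)) =
      (posVolume.prod posVolume).withDensity (fun z => φ z.1 * ψ z.2) := by
    rw [h, ← prod_withDensity (Measure.measurable_rnDeriv _ _) (Measure.measurable_rnDeriv _ _),
      Measure.withDensity_rnDeriv_eq _ _ hac₁, Measure.withDensity_rnDeriv_eq _ _ hac₂]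
  have hφm : Measurable φ := Measure.measurable_rnDeriv _ _
  have hψm : Measurable ψ := Measure.measurable_rnDeriv _ _
  rw [withDensity_eq_iff_of_sigmaFinite hGm (by fun_prop)] at hprod
  have hae := Measure.ae_ae_of_ae_prod hprod
  have hslice : ∀ u, 0 < u → ContinuousOn (fun v => G (u, v)) (Ioi 0) := fun u hu =>
    hG.comp (by fun_prop) fun v hv => ⟨hu, hv⟩
  have hslice' : ∀ v, 0 < v → ContinuousOn (fun u => G (u, v)) (Ioi 0) := fun v hv =>
    hG.comp (by fun_prop) fun u hu => ⟨hu, hv⟩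
  have hmem : ∀ᵐ v ∂posVolume, v ∈ Ioi (0 : ℝ) := ae_restrict_mem measurableSet_Ioi
  have hne : posVolume ≠ 0 := by
    intro h0
    have := congrArg (fun μ : Measure ℝ => μ univ) h0
    simp at this
  have : (ae posVolume).NeBot := ae_neBot.2 hne
  have hgood : ∀ᵐ u ∂posVolume, ∀ᵐ u' ∂posVolume, ∀ v v' : ℝ, 0 < v → 0 < v' →
      G (u, v) * G (u', v') = G (u, v') * G (u', v) := by
    filter_upwards [hae, hmem] with u hu hu0
    filter_upwards [hae, hmem] with u' hu' hu'0
    -- Both 0 and ∞ have real part 0, so both must be excluded before cancelling φ.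
    have hfin : ∀ u, 0 < u → (∀ᵐ v ∂posVolume, ENNReal.ofReal (G (u, v)) = φ u * ψ v) →
        0 < (φ u).toReal := by
      intro u hu0 hu
      obtain ⟨v, hv, hv0⟩ := (hu.and hmem).exists
      have hp := ENNReal.ofReal_pos.2 (hpos (u, v) ⟨hu0, hv0⟩)
      rw [hv] at hp
      have hp' := ENNReal.mul_pos_iff.1 hp
      refine ENNReal.toReal_pos hp'.1.ne' fun htop => ?_
      rw [htop, ENNReal.top_mul hp'.2.ne'] at hv
      exact ENNReal.ofReal_ne_top hv
    -- Almost every two slices of G are proportional for almost every v, hence by continuity for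
    -- every v.
    have heq : EqOn (fun v => G (u, v) * (φ u').toReal) (fun v => G (u', v) * (φ u).toReal)
        (Ioi 0) := by
      refine Measure.eqOn_open_of_ae_eq (μ := volume) ?_ isOpen_Ioi
        ((hslice u hu0).mul continuousOn_const) ((hslice u' hu'0).mul continuousOn_const)
      filter_upwards [hu, hu', hmem] with v hv hv' hv0
      have e1 : G (u, v) = (φ u).toReal * (ψ v).toReal := by
        rw [← ENNReal.toReal_mul, ← hv, ENNReal.toReal_ofReal (hpos (u, v) ⟨hu0, hv0⟩).le]
      have e2 : G (u', v) = (φ u').toReal * (ψ v).toReal := by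
        rw [← ENNReal.toReal_mul, ← hv', ENNReal.toReal_ofReal (hpos (u', v) ⟨hu'0, hv0⟩).le]
      rw [e1, e2]
      ring
    intro v v' hv hv'
    have h1 := heq hv
    have h2 := heq hv'
    simp only at h1 h2
    have hφu := hfin u hu0 hu
    have hφu' := hfin u' hu'0 hu'
    refine mul_right_cancel₀ (mul_pos hφu hφu').ne' ?_
    linear_combination (G (u', v') * (φ u).toReal) * h1 - (G (u', v) * (φ u).toReal) * h2
  have hstep : ∀ᵐ u ∂posVolume, ∀ u' v v' : ℝ, 0 < u' → 0 < v → 0 < v' →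
      G (u, v) * G (u', v') = G (u, v') * G (u', v) := by
    -- The exceptional null sets for u', and then for u, are removed by continuity too.
    filter_upwards [hgood] with u hu u' v v' hu' hv hv'
    refine Measure.eqOn_open_of_ae_eq (μ := volume) (U := Ioi (0 : ℝ))
      (f := fun u' => G (u, v) * G (u', v')) (g := fun u' => G (u, v') * G (u', v)) ?_ isOpen_Ioi
      (continuousOn_const.mul (hslice' v' hv')) (continuousOn_const.mul (hslice' v hv)) hu'
    filter_upwards [hu] with u' h' using h' v v' hv hv'
  refine Measure.eqOn_open_of_ae_eq (μ := volume) (U := Ioi (0 : ℝ))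
    (f := fun u => G (u, v) * G (u', v')) (g := fun u => G (u, v') * G (u', v)) ?_ isOpen_Ioi
    ((hslice' v hv).mul continuousOn_const) ((hslice' v' hv').mul continuousOn_const) hu
  filter_upwards [hstep] with u h' using h' u' v v' hu' hv hv'

/-- A probability measure proportional to a product measure is the product of its marginals. -/
theorem marginals_of_eq_smul_prod {μ : Measure (ℝ × ℝ)} [IsProbabilityMeasure μ]
    {m₁ m₂ : Measure ℝ} [SFinite m₁] [SFinite m₂] {c : ENNReal} (h : μ = c • m₁.prod m₂) :
    μ.map Prod.fst = (c * m₂ univ) • m₁ ∧ μ.map Prod.snd = (c * m₁ univ) • m₂ ∧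
      μ = (μ.map Prod.fst).prod (μ.map Prod.snd) := by
  have h1 : μ.map Prod.fst = (c * m₂ univ) • m₁ := by
    rw [h, Measure.map_smul, Measure.map_fst_prod, smul_smul]
  have h2 : μ.map Prod.snd = (c * m₁ univ) • m₂ := by
    rw [h, Measure.map_smul, Measure.map_snd_prod, smul_smul]
  have hone : c * (m₁ univ * m₂ univ) = 1 := by
    rw [← measure_univ (μ := μ), h, Measure.smul_apply, smul_eq_mul, ← univ_prod_univ,
      Measure.prod_prod]
  refine ⟨h1, h2, ?_⟩
  rw [h1, h2, Measure.prod_smul_left, Measure.prod_smul_right, smul_smul]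
  conv_lhs => rw [h]
  congr 1
  calc c = c * (c * (m₁ univ * m₂ univ)) := by rw [hone, mul_one]
    _ = c * m₂ univ * (c * m₁ univ) := by ring

/-! ### Generalized inverse Gaussian weights -/

/-- The weight `x ^ (l - 1) * exp (-a x - b / x)`. -/
noncomputable def gigWeight (l a b x : ℝ) : ℝ := x ^ (l - 1) * Real.exp (-a * x - b * x⁻¹)

/-- The measure on `(0, ∞)` with density `gigWeight l a b`. -/
noncomputable def gigWeightMeasure (l a b : ℝ) : Measure ℝ :=
  posVolume.withDensity fun x => ENNReal.ofReal (gigWeight l a b x)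

instance (l a b : ℝ) : SFinite (gigWeightMeasure l a b) := by
  unfold gigWeightMeasure; infer_instance

theorem measurable_gigWeight (l a b : ℝ) : Measurable (gigWeight l a b) := by
  unfold gigWeight
  fun_prop

theorem gigWeight_pos (l a b : ℝ) {x : ℝ} (hx : 0 < x) : 0 < gigWeight l a b x := by
  unfold gigWeight
  positivity

theorem continuousOn_gigWeight (l a b : ℝ) : ContinuousOn (gigWeight l a b) (Ioi 0) := by
  have h : ∀ x ∈ Ioi (0 : ℝ), x ≠ 0 := fun x hx => ne_of_gt hx
  unfold gigWeight
  refine ContinuousOn.mul (continuousOn_id.rpow_const fun x hx => Or.inl (h x hx)) ?_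
  exact ((continuousOn_const.mul continuousOn_id).sub
    (continuousOn_const.mul (continuousOn_id.inv₀ h))).rexp

theorem gigZ_eq_toReal (l a b : ℝ) : gigZ l a b = (gigWeightMeasure l a b univ).toReal := by
  rw [gigWeightMeasure, withDensity_apply _ MeasurableSet.univ, Measure.restrict_univ]
  exact integral_eq_lintegral_of_nonneg_ae
    (by filter_upwards [ae_restrict_mem measurableSet_Ioi] with x hx
        exact (gigWeight_pos l a b hx).le) (measurable_gigWeight l a b).aestronglyMeasurable

theorem gigMeasure_eq_smul (l a b : ℝ) :
    gigMeasure l a b =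
      ENNReal.ofReal (1 / (gigWeightMeasure l a b univ).toReal) • gigWeightMeasure l a b := by
  rw [← gigZ_eq_toReal, gigMeasure, gigWeightMeasure,
    ← withDensity_smul _ (measurable_gigWeight l a b).ennreal_ofReal,
    ← withDensity_indicator measurableSet_Ioi]
  congr 1
  funext x
  have h0 : 0 ≤ 1 / gigZ l a b := by rw [gigZ_eq_toReal]; positivity
  by_cases hx : x ∈ Ioi (0 : ℝ)
  · simp only [gigPDFReal, indicator_of_mem hx, Pi.smul_apply, smul_eq_mul,
      ENNReal.ofReal_mul h0, gigWeight]
  · simp only [gigPDFReal, indicator_of_notMem hx, ENNReal.ofReal_zero]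

/-- Total mass 1 forces the weight's mass to be positive and finite and c to be its inverse, so the
default value of the normalizing constant plays no role. -/
theorem gigMeasure_eq_of_smul_apply_univ {l a b : ℝ} {c : ENNReal}
    (h : (c • gigWeightMeasure l a b) univ = 1) :
    gigMeasure l a b = c • gigWeightMeasure l a b := by
  rw [gigMeasure_eq_smul]
  set m := gigWeightMeasure l a b univ with hm
  have h1 : c * m = 1 := by rwa [Measure.smul_apply, smul_eq_mul] at h
  have h0 : m ≠ 0 := by rintro h0; simp [h0] at h1
  have htop : m ≠ ⊤ := by
    rintro ht
    rw [ht] at h1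
    rcases eq_or_ne c 0 with hc | hc
    · simp [hc] at h1
    · simp [ENNReal.mul_top hc] at h1
  congr 1
  rw [one_div, ENNReal.ofReal_inv_of_pos (ENNReal.toReal_pos h0 htop), ENNReal.ofReal_toReal htop]
  exact (ENNReal.eq_inv_of_mul_eq_one_left h1).symm

/-- With (u, v) the image of (x, y), uv = xy matches the powers, while αu + 1/v = βy + 1/x and βv +
1/u = αx + 1/y match the c₁ and c₂ parts of the exponents. -/
theorem gigWeight_gigMap {α β : ℝ} (hα : 0 ≤ α) (hβ : 0 ≤ β) (l c₁ c₂ : ℝ) {z : ℝ × ℝ}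
    (hz : z ∈ Ioi (0 : ℝ) ×ˢ Ioi (0 : ℝ)) :
    gigWeight l (c₁ * α) c₂ (gigMap α β z).1 * gigWeight l (c₂ * β) c₁ (gigMap α β z).2 =
      gigWeight l (c₂ * α) c₁ z.1 * gigWeight l (c₁ * β) c₂ z.2 := by
  have hF := gigMap_mapsTo hα hβ hz
  obtain ⟨x, y⟩ := z
  obtain ⟨hx, hy⟩ := hz
  obtain ⟨hu, hv⟩ := hF
  simp only [mem_Ioi] at hx hy hu hv
  have ha : 0 < 1 + α * x * y := by positivity
  have hb : 0 < 1 + β * x * y := by positivity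
  have hprod : (gigMap α β (x, y)).1 * (gigMap α β (x, y)).2 = x * y := by
    simp only [gigMap]; field_simp
  unfold gigWeight
  rw [mul_mul_mul_comm, mul_mul_mul_comm (x ^ (l - 1)), ← Real.mul_rpow hu.le hv.le, hprod,
    ← Real.mul_rpow hx.le hy.le, ← Real.exp_add, ← Real.exp_add]
  congr 2
  simp only [gigMap]
  field_simp
  ring

theorem integrableOn_gigWeight {l a b : ℝ} (h : gigWeightMeasure l a b univ ≠ ⊤) :
    IntegrableOn (gigWeight l a b) (Ioi 0) := by
  rw [gigWeightMeasure, withDensity_apply _ MeasurableSet.univ, Measure.restrict_univ] at h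
  exact (lintegral_ofReal_ne_top_iff_integrable
    (measurable_gigWeight l a b).aestronglyMeasurable
    (by filter_upwards [ae_restrict_mem measurableSet_Ioi] with x hx
        exact (gigWeight_pos l a b hx).le)).1 h

theorem integrableOn_rpow_of_exp_le {l a b k : ℝ} {s : Set ℝ} (hs : MeasurableSet s)
    (hs0 : s ⊆ Ioi 0) (h : gigWeightMeasure l a b univ ≠ ⊤)
    (hk : ∀ x ∈ s, k ≤ -a * x - b * x⁻¹) : IntegrableOn (fun x : ℝ => x ^ (l - 1)) s := by
  refine Integrable.mono' (((integrableOn_gigWeight h).mono_set hs0).const_mul (Real.exp (-k)))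
    (by fun_prop) ?_
  filter_upwards [ae_restrict_mem hs] with x hx
  have hx0 : 0 < x := hs0 hx
  rw [Real.norm_of_nonneg (by positivity), gigWeight, mul_left_comm, ← Real.exp_add]
  refine le_mul_of_one_le_right (by positivity) (Real.one_le_exp ?_)
  linarith [hk x hx]

/-- If b ≤ 0, the exponential is bounded below on (0, 1), so the power itself must be integrable at
0. -/
theorem pos_of_gigWeightMeasure_ne_top {l a b : ℝ} (h : gigWeightMeasure l a b univ ≠ ⊤)
    (hb : b ≤ 0) : 0 < l := by
  have := integrableOn_rpow_of_exp_le (k := -|a|) measurableSet_Ioo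
    (fun x (hx : x ∈ Ioo (0 : ℝ) 1) => hx.1) h fun x hx => by
      have h1 : 0 < x⁻¹ := inv_pos.2 hx.1
      have h2 : a * x ≤ |a| := (le_abs_self _).trans (by
        rw [abs_mul, abs_of_pos hx.1]
        exact mul_le_of_le_one_right (abs_nonneg a) hx.2.le)
      nlinarith [mul_nonneg (neg_nonneg.2 hb) h1.le]
  rw [intervalIntegral.integrableOn_Ioo_rpow_iff zero_lt_one] at this
  linarith

/-- The counterpart at ∞: if a ≤ 0, the exponential is bounded below on (1, ∞). -/
theorem neg_of_gigWeightMeasure_ne_top {l a b : ℝ} (h : gigWeightMeasure l a b univ ≠ ⊤)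
    (ha : a ≤ 0) : l < 0 := by
  have := integrableOn_rpow_of_exp_le (k := -|b|) measurableSet_Ioi
    (Ioi_subset_Ioi (zero_le_one (α := ℝ))) h fun x hx => by
      have hx0 : 0 < x := zero_lt_one.trans hx
      have h1 : b * x⁻¹ ≤ |b| := (le_abs_self _).trans (by
        rw [abs_mul, abs_of_pos (inv_pos.2 hx0)]
        exact mul_le_of_le_one_right (abs_nonneg b) (inv_le_one_of_one_le₀ (le_of_lt hx)))
      nlinarith [mul_nonneg (neg_nonneg.2 ha) hx0.le]
  rw [integrableOn_Ioi_rpow_iff zero_lt_one] at this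
  linarith

theorem withDensity_eq_smul_gigWeightMeasure {f : ℝ → ℝ} {l a b K : ℝ} (hK : 0 < K)
    (hf : ∀ x, 0 < x → f x = K * gigWeight l a b x) :
    posVolume.withDensity (fun x => ENNReal.ofReal (f x)) =
      ENNReal.ofReal K • gigWeightMeasure l a b := by
  rw [gigWeightMeasure, ← withDensity_smul _ (measurable_gigWeight l a b).ennreal_ofReal]
  refine withDensity_congr_ae ?_
  filter_upwards [ae_restrict_mem measurableSet_Ioi] with x hx
  rw [hf x hx, ENNReal.ofReal_mul hK.le]
  rfl

/-! ### Independence and laws of the image -/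

section

variable {Ω : Type*} [MeasurableSpace Ω] {P : Measure Ω} {α β : ℝ} {X Y U V : Ω → ℝ}

theorem hasLaw_gigMap_of_withDensity [IsProbabilityMeasure P] (hα : 0 ≤ α) (hβ : 0 ≤ β)
    (hXY : IndepFun X Y P) {f h : ℝ → ENNReal} (hf : AEMeasurable f posVolume)
    (hh : AEMeasurable h posVolume) (hX : HasLaw X (posVolume.withDensity f) P)
    (hY : HasLaw Y (posVolume.withDensity h) P) :
    HasLaw (fun ω => gigMap α β (X ω, Y ω)) ((posVolume.prod posVolume).withDensity
      (fun z => f (gigMap α β z).1 * h (gigMap α β z).2)) P := by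
  have h1 := hXY.hasLaw_prod hX hY
  rw [prod_withDensity₀ hf hh] at h1
  have hm : AEMeasurable (fun z : ℝ × ℝ => f z.1 * h z.2) (posVolume.prod posVolume) :=
    (hf.comp_quasiMeasurePreserving Measure.quasiMeasurePreserving_fst).mul
      (hh.comp_quasiMeasurePreserving Measure.quasiMeasurePreserving_snd)
  exact HasLaw.comp ⟨(measurable_gigMap α β).aemeasurable, map_gigMap_withDensity hα hβ hm⟩ h1

theorem TwiceDiffOnPos.aemeasurable {f : ℝ → ℝ} (hf : TwiceDiffOnPos f) :
    AEMeasurable f posVolume :=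
  hf.1.continuousOn.aemeasurable measurableSet_Ioi

/-- Independence of the image coordinates forces generalized inverse Gaussian laws. -/
theorem exists_hasLaw_gigMeasure_of_indepFun [IsProbabilityMeasure P] (hα : 0 ≤ α) (hβ : 0 ≤ β)
    (hαβ : α ≠ β) (hX : HasNicePosDensity X P) (hY : HasNicePosDensity Y P)
    (hXY : IndepFun X Y P) (hUV : ∀ ω, (U ω, V ω) = gigMap α β (X ω, Y ω))
    (hind : IndepFun U V P) :
    ∃ l c₁ c₂ : ℝ, 0 < c₁ ∧ 0 < c₂ ∧
      HasLaw X (gigMeasure l (c₁ * α) c₂) P ∧ HasLaw Y (gigMeasure l (c₂ * β) c₁) P := by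
  obtain ⟨f, hfpos, hf, hfX⟩ := hX
  obtain ⟨h, hhpos, hh, hhY⟩ := hY
  have hlaw := hasLaw_gigMap_of_withDensity hα hβ hXY hf.aemeasurable.ennreal_ofReal
    hh.aemeasurable.ennreal_ofReal hfX hhY
  simp only [← hUV] at hlaw
  have hU : AEMeasurable U P := measurable_fst.comp_aemeasurable hlaw.aemeasurable
  have hV : AEMeasurable V P := measurable_snd.comp_aemeasurable hlaw.aemeasurable
  have := Measure.isProbabilityMeasure_map hU
  have := Measure.isProbabilityMeasure_map hV
  set G : ℝ × ℝ → ℝ := fun z => f (gigMap α β z).1 * h (gigMap α β z).2 with hG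
  have hmaps : MapsTo (gigMap α β) (Ioi 0 ×ˢ Ioi 0) (Ioi 0 ×ˢ Ioi 0) := gigMap_mapsTo hα hβ
  have hGc : ContinuousOn G (Ioi 0 ×ˢ Ioi 0) :=
    (hf.1.continuousOn.comp (continuous_fst.comp_continuousOn (continuousOn_gigMap hα hβ))
      fun z hz => (hmaps hz).1).mul
    (hh.1.continuousOn.comp (continuous_snd.comp_continuousOn (continuousOn_gigMap hα hβ))
      fun z hz => (hmaps hz).2)
  have hGpos : ∀ z ∈ Ioi (0 : ℝ) ×ˢ Ioi (0 : ℝ), 0 < G z := fun z hz =>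
    mul_pos (hfpos _ (hmaps hz).1) (hhpos _ (hmaps hz).2)
  have hprod : (posVolume.prod posVolume).withDensity (fun z => ENNReal.ofReal (G z)) =
      (P.map U).prod (P.map V) := by
    rw [← hind.map_prod_eq_prod_map_map hU hV, hlaw.map_eq]
    refine withDensity_congr_ae ?_
    filter_upwards [ae_mem_quadrant] with z hz
    exact ENNReal.ofReal_mul (hfpos _ (hmaps hz).1).le
  obtain ⟨l, c₁, c₂, K, L, hK, hL, hfw, hhw⟩ := exists_eq_gig_weight hα hβ hαβ hf hfpos hh hhpos
    fun u u' v v' hu hu' hv hv' =>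
      mul_eq_mul_of_withDensity_eq_prod hGc hGpos hprod hu hu' hv hv'
  have hlaw' : ∀ {Z : Ω → ℝ} {g : ℝ → ℝ} {a b k : ℝ}, 0 < k →
      HasLaw Z (posVolume.withDensity (fun x => ENNReal.ofReal (g x))) P →
      (∀ x, 0 < x → g x = k * gigWeight l a b x) →
      HasLaw Z (gigMeasure l a b) P ∧ gigWeightMeasure l a b univ ≠ ⊤ := by
    intro Z g a b k hk hZ hg
    rw [withDensity_eq_smul_gigWeightMeasure hk hg] at hZ
    have h1 : (ENNReal.ofReal k • gigWeightMeasure l a b) univ = 1 :=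
      (hZ.isProbabilityMeasure_iff.1 inferInstance).measure_univ
    refine ⟨(gigMeasure_eq_of_smul_apply_univ h1).symm ▸ hZ, fun htop => ?_⟩
    rw [Measure.smul_apply, htop, smul_eq_mul,
      ENNReal.mul_top (ENNReal.ofReal_pos.2 hk).ne'] at h1
    exact ENNReal.top_ne_one h1
  obtain ⟨hX', hXtop⟩ := hlaw' hK hfX hfw
  obtain ⟨hY', hYtop⟩ := hlaw' hL hhY hhw
  refine ⟨l, c₁, c₂, ?_, ?_, hX', hY'⟩
  -- If c₁ ≤ 0, the law of Y near 0 forces l > 0, while that of X near ∞ forces l < 0. The case of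
  -- c₂ exchanges X and Y.
  · by_contra! hc
    exact lt_asymm (pos_of_gigWeightMeasure_ne_top hYtop hc)
      (neg_of_gigWeightMeasure_ne_top hXtop (mul_nonpos_of_nonpos_of_nonneg hc hα))
  · by_contra! hc
    exact lt_asymm (pos_of_gigWeightMeasure_ne_top hXtop hc)
      (neg_of_gigWeightMeasure_ne_top hYtop (mul_nonpos_of_nonpos_of_nonneg hc hβ))

/-- The map sends a product of generalized inverse Gaussian laws to such a product. -/
theorem indepFun_and_hasLaw_of_hasLaw_gigMeasure [IsProbabilityMeasure P] (hα : 0 ≤ α)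
    (hβ : 0 ≤ β) (hXY : IndepFun X Y P) (hUV : ∀ ω, (U ω, V ω) = gigMap α β (X ω, Y ω))
    {l c₁ c₂ : ℝ} (hX : HasLaw X (gigMeasure l (c₁ * α) c₂) P)
    (hY : HasLaw Y (gigMeasure l (c₂ * β) c₁) P) :
    IndepFun U V P ∧ HasLaw U (gigMeasure l (c₂ * α) c₁) P ∧
      HasLaw V (gigMeasure l (c₁ * β) c₂) P := by
  have hmw : ∀ l a b, Measurable fun x => ENNReal.ofReal (gigWeight l a b x) := fun l a b =>
    (measurable_gigWeight l a b).ennreal_ofReal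
  rw [gigMeasure_eq_smul] at hX hY
  set k₁ := ENNReal.ofReal (1 / (gigWeightMeasure l (c₁ * α) c₂ univ).toReal) with hk₁
  set k₂ := ENNReal.ofReal (1 / (gigWeightMeasure l (c₂ * β) c₁ univ).toReal) with hk₂
  rw [gigWeightMeasure, ← withDensity_smul _ (hmw _ _ _)] at hX hY
  have hlaw := hasLaw_gigMap_of_withDensity hα hβ hXY ((hmw _ _ _).const_smul k₁).aemeasurable
    ((hmw _ _ _).const_smul k₂).aemeasurable hX hY
  simp only [← hUV] at hlaw
  have hU : AEMeasurable U P := measurable_fst.comp_aemeasurable hlaw.aemeasurable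
  have hV : AEMeasurable V P := measurable_snd.comp_aemeasurable hlaw.aemeasurable
  have hjoint : P.map (fun ω => (U ω, V ω)) = (k₁ * k₂) •
      (gigWeightMeasure l (c₂ * α) c₁).prod (gigWeightMeasure l (c₁ * β) c₂) := by
    have hmw' : Measurable fun z : ℝ × ℝ => ENNReal.ofReal (gigWeight l (c₂ * α) c₁ z.1) *
        ENNReal.ofReal (gigWeight l (c₁ * β) c₂ z.2) :=
      ((hmw _ _ _).comp measurable_fst).mul ((hmw _ _ _).comp measurable_snd)
    rw [hlaw.map_eq, gigWeightMeasure, gigWeightMeasure, prod_withDensity (hmw _ _ _) (hmw _ _ _),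
      ← withDensity_smul _ hmw']
    refine withDensity_congr_ae ?_
    filter_upwards [ae_mem_quadrant] with z hz
    have hF := gigMap_mapsTo hα hβ hz
    simp only [Pi.smul_apply, smul_eq_mul]
    rw [mul_mul_mul_comm, ← ENNReal.ofReal_mul (gigWeight_pos _ _ _ hF.1).le,
      gigWeight_gigMap hα hβ l c₁ c₂ hz, ENNReal.ofReal_mul (gigWeight_pos _ _ _ hz.1).le]
  have := Measure.isProbabilityMeasure_map hlaw.aemeasurable
  obtain ⟨h1, h2, h3⟩ := marginals_of_eq_smul_prod hjoint
  have e1 : (P.map fun ω => (U ω, V ω)).map Prod.fst = P.map U :=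
    AEMeasurable.map_map_of_aemeasurable measurable_fst.aemeasurable hlaw.aemeasurable
  have e2 : (P.map fun ω => (U ω, V ω)).map Prod.snd = P.map V :=
    AEMeasurable.map_map_of_aemeasurable measurable_snd.aemeasurable hlaw.aemeasurable
  rw [e1] at h1 h3
  rw [e2] at h2 h3
  refine ⟨(indepFun_iff_map_prod_eq_prod_map_map hU hV).2 h3, ⟨hU, ?_⟩, ⟨hV, ?_⟩⟩
  · rw [gigMeasure_eq_of_smul_apply_univ (c := k₁ * k₂ * gigWeightMeasure l (c₁ * β) c₂ univ), h1]
    rw [← h1]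
    exact (Measure.isProbabilityMeasure_map hU).measure_univ
  · rw [gigMeasure_eq_of_smul_apply_univ (c := k₁ * k₂ * gigWeightMeasure l (c₂ * α) c₁ univ), h2]
    rw [← h2]
    exact (Measure.isProbabilityMeasure_map hV).measure_univ

end

/-! ### Equality of parameters and the main theorem -/

theorem eq_of_gigMeasure_eq {l c₁ c₂ : ℝ} (hα : 0 ≤ α)
    [IsProbabilityMeasure (gigMeasure l (c₁ * α) c₂)]
    (h : gigMeasure l (c₁ * α) c₂ = gigMeasure l (c₂ * α) c₁) : c₁ = c₂ := by
  have hone : gigMeasure l (c₁ * α) c₂ univ = 1 := measure_univ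
  have hone' : gigMeasure l (c₂ * α) c₁ univ = 1 := h ▸ hone
  rw [gigMeasure_eq_smul, gigMeasure_eq_smul] at h
  rw [gigMeasure_eq_smul] at hone hone'
  set k := 1 / (gigWeightMeasure l (c₁ * α) c₂ univ).toReal with hk
  set k' := 1 / (gigWeightMeasure l (c₂ * α) c₁ univ).toReal with hk'
  have hkpos : ∀ {r : ℝ} {μ : Measure ℝ}, (ENNReal.ofReal r • μ) univ = 1 → 0 < r := by
    intro r μ hr
    by_contra! hr0
    simp [ENNReal.ofReal_of_nonpos hr0] at hr
  have hk0 := hkpos hone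
  have hk0' := hkpos hone'
  have hmw : ∀ l a b, Measurable fun x => ENNReal.ofReal (gigWeight l a b x) := fun l a b =>
    (measurable_gigWeight l a b).ennreal_ofReal
  rw [gigWeightMeasure, gigWeightMeasure, ← withDensity_smul _ (hmw _ _ _),
    ← withDensity_smul _ (hmw _ _ _), withDensity_eq_iff_of_sigmaFinite
      ((hmw _ _ _).const_smul _).aemeasurable ((hmw _ _ _).const_smul _).aemeasurable] at h
  have heq : EqOn (fun x => k * gigWeight l (c₁ * α) c₂ x) (fun x => k' * gigWeight l (c₂ * α) c₁ x)
      (Ioi 0) := by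
    refine Measure.eqOn_open_of_ae_eq (μ := volume) ?_ isOpen_Ioi
      (continuousOn_const.mul (continuousOn_gigWeight _ _ _))
      (continuousOn_const.mul (continuousOn_gigWeight _ _ _))
    filter_upwards [h, ae_restrict_mem measurableSet_Ioi] with x hx hx0
    simp only [Pi.smul_apply, smul_eq_mul] at hx
    rw [← ENNReal.ofReal_mul hk0.le, ← ENNReal.ofReal_mul hk0'.le] at hx
    exact (ENNReal.ofReal_eq_ofReal_iff (mul_pos hk0 (gigWeight_pos _ _ _ hx0)).le
      (mul_pos hk0' (gigWeight_pos _ _ _ hx0)).le).1 hx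
  have hlog : ∀ x, 0 < x → Real.log k + (-(c₁ * α) * x - c₂ * x⁻¹) =
      Real.log k' + (-(c₂ * α) * x - c₁ * x⁻¹) := by
    intro x hx
    have h1 : k * gigWeight l (c₁ * α) c₂ x = k' * gigWeight l (c₂ * α) c₁ x := heq hx
    have hxl : 0 < x ^ (l - 1) := by positivity
    have h2 : k * Real.exp (-(c₁ * α) * x - c₂ * x⁻¹) =
        k' * Real.exp (-(c₂ * α) * x - c₁ * x⁻¹) := by
      refine mul_left_cancel₀ hxl.ne' ?_
      unfold gigWeight at h1
      linear_combination h1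
    have h3 := congrArg Real.log h2
    rwa [Real.log_mul hk0.ne' (Real.exp_pos _).ne', Real.log_mul hk0'.ne' (Real.exp_pos _).ne',
      Real.log_exp, Real.log_exp] at h3
  have h1 := hlog 1 one_pos
  have h2 := hlog 2 two_pos
  -- Subtracting the values at 1 and 2 removes the normalizing constants; α + 1/2 > 0 since α ≥ 0.
  have h3 : (c₂ - c₁) * (α + 1 / 2) = 0 := by
    linear_combination h2 - h1
  rcases mul_eq_zero.1 h3 with h4 | h4
  · linarith
  · linarith

theorem theorem1p1 {Ω : Type*} [MeasurableSpace Ω] (P : Measure Ω) [IsProbabilityMeasure P]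
    (α β : ℝ) (hα : 0 ≤ α) (hβ : 0 ≤ β) (hαβ : α ≠ β)
    (X Y : Ω → ℝ) (hX : HasNicePosDensity X P) (hY : HasNicePosDensity Y P)
    (hXY : IndepFun X Y P)
    (U V : Ω → ℝ) (hUV : ∀ ω, (U ω, V ω) = gigMap α β (X ω, Y ω)) :
    (IndepFun U V P ↔
      ∃ l c₁ c₂ : ℝ, 0 < c₁ ∧ 0 < c₂ ∧
        HasLaw X (gigMeasure l (c₁ * α) c₂) P ∧ HasLaw Y (gigMeasure l (c₂ * β) c₁) P) ∧
    (∀ l c₁ c₂ : ℝ, 0 < c₁ → 0 < c₂ →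
      HasLaw X (gigMeasure l (c₁ * α) c₂) P → HasLaw Y (gigMeasure l (c₂ * β) c₁) P →
        HasLaw U (gigMeasure l (c₂ * α) c₁) P ∧ HasLaw V (gigMeasure l (c₁ * β) c₂) P) ∧
    (IdentDistrib (fun ω => (U ω, V ω)) (fun ω => (X ω, Y ω)) P P →
      ∃ l c : ℝ, 0 < c ∧
        HasLaw X (gigMeasure l (c * α) c) P ∧ HasLaw Y (gigMeasure l (c * β) c) P) := by
  have hforward := exists_hasLaw_gigMeasure_of_indepFun hα hβ hαβ hX hY hXY hUV
  refine ⟨⟨hforward, ?_⟩, ?_, ?_⟩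
  · rintro ⟨l, c₁, c₂, -, -, hX', hY'⟩
    exact (indepFun_and_hasLaw_of_hasLaw_gigMeasure hα hβ hXY hUV hX' hY').1
  · intro l c₁ c₂ _ _ hX' hY'
    exact (indepFun_and_hasLaw_of_hasLaw_gigMeasure hα hβ hXY hUV hX' hY').2
  · intro hid
    have hUX : IdentDistrib U X P P := hid.comp measurable_fst
    have hVY : IdentDistrib V Y P P := hid.comp measurable_snd
    -- The law of (U, V) is that of (X, Y), a product of marginals.
    have hind : IndepFun U V P := by
      rw [indepFun_iff_map_prod_eq_prod_map_map hUX.aemeasurable_fst hVY.aemeasurable_fst,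
        hid.map_eq, hUX.map_eq, hVY.map_eq]
      exact hXY.map_prod_eq_prod_map_map hUX.aemeasurable_snd hVY.aemeasurable_snd
    obtain ⟨l, c₁, c₂, hc₁, -, hX', hY'⟩ := hforward hind
    have hU' := (indepFun_and_hasLaw_of_hasLaw_gigMeasure hα hβ hXY hUV hX' hY').2.1
    have : IsProbabilityMeasure (gigMeasure l (c₁ * α) c₂) :=
      hX'.isProbabilityMeasure_iff.1 inferInstance
    obtain rfl : c₁ = c₂ := eq_of_gigMeasure_eq hα
      (by rw [← hX'.map_eq, ← hU'.map_eq, hUX.map_eq])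
    exact ⟨l, c₁, hc₁, hX', hY'⟩
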